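/- Theorem (Exact complexity of distributed top-$k$ selection). Scores. Let $1\le k\le n$ and let $s_1,\dots,s_n\in\mathbb R$ be scores held by $n$ agents, sorted in descending order as $\theta_1\ge\dots\ge\theta_n$, and suppose that not all scores equal $\theta_k$. Let $\overline m$ (resp. $\underline m$) be the number of indices $j\le k$ (resp. $j>k$) with $\theta_j=\theta_k$, and put $g_m=\min\{\overline m-\tfrac12,\ \underline m+\tfrac12\}$ and $\Delta=\min\{|s_i-\theta_k| : s_i\ne\theta_k\}$. Let $p=\frac{n-k}{n}+\frac1{2n}$, let $\rho_p(x)=px$ for $x\ge0$ and $\rho_p(x)=-(1-p)x$ for $x<0$, and put $f_i(x)=\rho_p(s_i-x)$, $f=\sum_{i=1}^n f_i$. Smoothing (Assumption 1). For a fixed smoothing parameter $h$, let $\tilde f_i^h:\mathbb R\to\mathbb R$ $(1\le i\le n)$ be convex, differentiable functions such that each difference $f_i-\tilde f_i^h$ is bounded on $\mathbb R$, and put $\tilde f_h=\sum_{i=1}^n\tilde f_i^h$. Assume that $\tilde f_h$ is $L_h$-Lipschitz, that $\tilde f_h'$ is $M_h$-Lipschitz, that $|f(x)-\tilde f_h(x)|\le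 U_h$ for all $x\in\mathbb R$, and that each $(\tilde f_i^h)'$ is $\frac{M_h}{n}$-Lipschitz. Assume that $U_h\le g_m\Delta/8$. Let $\theta_k^h$ be a minimizer of $\tilde f_h$. Network. Let $\mathcal G$ be a connected undirected graph on $\{1,\dots,n\}$, and let $W\in\mathbb R^{n\times n}$ be a weight matrix for it: $W=W^{T}$, $W\mathbf 1=\mathbf 1$, $W_{ij}=0$ if $i\neq j$ are not adjacent, and the spectral radius of $W-\frac1n\mathbf 1\mathbf 1^{T}$ is less than $1$. Let $\sigma_2(W)$ be the second largest singular value of $W$, and let $\mathcal N_i$ consist of $i$ and its neighbours. Algorithm 1 (EXTRA). Let $\beta=\frac{M_h}{n\sqrt{1-\sigma_2(W)}}$ and $\alpha=\frac1{2(M_h/n+\beta)}$. From arbitrary $w_i^0\in\mathbb R$ and from $v_i^0=0$, iterate for $t=0,1,2,\dots$ and all $i$ $$w_i^{t+1}=w_i^t-\alpha\Big((\tilde f_i^h)'(w_i^t)+v_i^t+\tfrac\beta2\big(w_i^t-\textstyle\sum_{j\in\mathcal N_i}W_{ij}w_j^t\big)\Big),\qquad v_i^{t+1}=v_i^t+\tfrac\beta2\big(w_i^{t+1}-\textstyle\sum_{j\in\mathcal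 N_i}W_{ij}w_j^{t+1}\big),$$ and let $\bar w_i^T=\frac1T\sum_{t=1}^T w_i^t$. Let $R_1$ be a constant with $|w_i^0-\theta_k^h|^2\le R_1$ for all $i$ and $|\theta_k^h|^2\le R_1$, and let $R_2=\max\{p^2,(1-p)^2\}$. Conclusion. For every natural number $$T\ \ge\ \frac{1}{g_m\Delta\sqrt{1-\sigma_2(W)}}\max\Big\{272\Big(R_1M_h+\frac{R_2n^2}{M_h}\Big),\ 32L_h\sqrt n\Big(\sqrt{R_1}+\sqrt{R_2}\,\frac n{M_h}\Big)\Big\}$$ the running average of every agent lies in the optimal solution interval: $\bar w_i^T\in\big(\theta_k-\frac\Delta2,\ \theta_k+\frac\Delta2\big)$, and in particular $|\bar w_i^T-\theta_k|\le\frac\Delta2$, for $i=1,\dots,n$. -/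

import Mathlib

/-! Top-`k` selection by smoothed distributed quantile estimation with the EXTRA algorithm. -/

noncomputable section

namespace TopK

/-! ### Scores -/

/-- The scores in descending order; `sortedScores s j` is the `(j+1)`-st largest score
(repetitions are counted). -/
def sortedScores {n : ℕ} (s : Fin n → ℝ) (j : Fin n) : ℝ :=
  s (Tuple.sort (fun i => -s i) j)

/-- `θ_k`, the `k`-th largest score, `1 ≤ k ≤ n`. -/
def kthLargest {n : ℕ} (s : Fin n → ℝ) (k : ℕ) (hk : 1 ≤ k ∧ k ≤ n) : ℝ :=
  sortedScores s ⟨k - 1, by omega⟩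

open scoped Classical in
/-- The number of scores equal to `θ_k` whose rank in the descending order is at most `k`. -/
def upperMult {n : ℕ} (s : Fin n → ℝ) (k : ℕ) (hk : 1 ≤ k ∧ k ≤ n) : ℕ :=
  (Finset.univ.filter fun j : Fin n =>
    sortedScores s j = kthLargest s k hk ∧ (j : ℕ) + 1 ≤ k).card

open scoped Classical in
/-- The number of scores equal to `θ_k` whose rank in the descending order exceeds `k`. -/
def lowerMult {n : ℕ} (s : Fin n → ℝ) (k : ℕ) (hk : 1 ≤ k ∧ k ≤ n) : ℕ :=
  (Finset.univ.filter fun j : Fin n =>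
    sortedScores s j = kthLargest s k hk ∧ k < (j : ℕ) + 1).card

/-- The multiplicity parameter `g_m`. -/
def multParam {n : ℕ} (s : Fin n → ℝ) (k : ℕ) (hk : 1 ≤ k ∧ k ≤ n) : ℝ :=
  min ((upperMult s k hk : ℝ) - 1 / 2) ((lowerMult s k hk : ℝ) + 1 / 2)

/-- The minimum gap `Δ` from `θ_k` to a score different from `θ_k`. The set is finite, so this
infimum is a minimum as soon as some score differs from `θ_k`. -/
def minGap {n : ℕ} (s : Fin n → ℝ) (k : ℕ) (hk : 1 ≤ k ∧ k ≤ n) : ℝ :=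
  sInf {d : ℝ | ∃ i, s i ≠ kthLargest s k hk ∧ d = |s i - kthLargest s k hk|}

/-- The optimal solution interval: the open interval around `θ_k` of radius `Δ / 2`. -/
def optimalInterval {n : ℕ} (s : Fin n → ℝ) (k : ℕ) (hk : 1 ≤ k ∧ k ≤ n) : Set ℝ :=
  Set.Ioo (kthLargest s k hk - minGap s k hk / 2) (kthLargest s k hk + minGap s k hk / 2)

/-! ### Quantile estimation and smoothing -/

/-- The quantile level `p = (n - k) / n + 1 / (2 n)`. -/
def quantileLevel (n k : ℕ) : ℝ :=
  ((n : ℝ) - (k : ℝ)) / (n : ℝ) + 1 / (2 * (n : ℝ))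

/-- The pinball loss `ρ_p`. -/
def pinball (p x : ℝ) : ℝ :=
  if 0 ≤ x then p * x else -(1 - p) * x

/-- The local objective `f_i(x) = ρ_p(s_i - x)`. -/
def localLoss {n : ℕ} (p : ℝ) (s : Fin n → ℝ) (i : Fin n) (x : ℝ) : ℝ :=
  pinball p (s i - x)

/-- `ft i` is a convex smooth approximation of `f i` for every `i`, and `∑ i, ft i` approximates
`∑ i, f i` with Lipschitz constant `L`, smoothness constant `M` and uniform error bound `U`. -/
structure IsSmoothApprox {n : ℕ} (f ft : Fin n → ℝ → ℝ) (L M U : ℝ) : Prop where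
  convex : ∀ i, ConvexOn ℝ Set.univ (ft i)
  differentiable : ∀ i, Differentiable ℝ (ft i)
  /-- `ft i` approximates `f i`: their difference is bounded, by some constant. -/
  local_error : ∀ i, ∃ C : ℝ, ∀ x, |f i x - ft i x| ≤ C
  lipschitz : ∀ x y, |∑ i, ft i x - ∑ i, ft i y| ≤ L * |x - y|
  smooth : ∀ x y,
    |deriv (fun z => ∑ i, ft i z) x - deriv (fun z => ∑ i, ft i z) y| ≤ M * |x - y|
  error : ∀ x, |∑ i, f i x - ∑ i, ft i x| ≤ U
  local_smooth : ∀ i x y, |deriv (ft i) x - deriv (ft i) y| ≤ M / (n : ℝ) * |x - y|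

/-! ### The network and the algorithm -/

/-- `W` is a weight matrix of the undirected graph `G`: symmetric, supported on the edges and the
diagonal, with unit row sums, and such that averaging with `W` converges, i.e. the spectral radius
of `W - (1/n) 1 1ᵀ` is less than one. -/
structure IsWeightMatrix {n : ℕ} (G : SimpleGraph (Fin n)) (W : Matrix (Fin n) (Fin n) ℝ) :
    Prop where
  symm : W.IsSymm
  support : ∀ i j, i ≠ j → ¬ G.Adj i j → W i j = 0
  row_sum : ∀ i, ∑ j, W i j = 1
  spectral : spectralRadius ℝ (W - Matrix.of fun _ _ => 1 / (n : ℝ)) < 1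

/-- `σ₂(W)`, the second largest singular value (Mathlib's singular values are in descending order
and indexed from `0`). -/
def sigmaTwo {n : ℕ} (W : Matrix (Fin n) (Fin n) ℝ) : ℝ :=
  (Matrix.toEuclideanLin W).singularValues 1

/-- `β = M / (n √(1 - σ₂(W)))`. -/
def beta {n : ℕ} (W : Matrix (Fin n) (Fin n) ℝ) (M : ℝ) : ℝ :=
  M / ((n : ℝ) * √(1 - sigmaTwo W))

/-- `α = 1 / (2 (M / n + β))`. -/
def alpha {n : ℕ} (W : Matrix (Fin n) (Fin n) ℝ) (M : ℝ) : ℝ :=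
  1 / (2 * (M / (n : ℝ) + beta W M))

open scoped Classical in
/-- `x_i - ∑_{j ∈ N_i} W_{ij} x_j`, where `N_i` consists of `i` and its neighbours in `G`. -/
def disagreement {n : ℕ} (G : SimpleGraph (Fin n)) (W : Matrix (Fin n) (Fin n) ℝ)
    (x : Fin n → ℝ) (i : Fin n) : ℝ :=
  x i - ∑ j ∈ Finset.univ.filter (fun j => j = i ∨ G.Adj i j), W i j * x j

/-- The primal update of EXTRA. -/
def primalStep {n : ℕ} (G : SimpleGraph (Fin n)) (W : Matrix (Fin n) (Fin n) ℝ)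
    (ft : Fin n → ℝ → ℝ) (a b : ℝ) (w v : Fin n → ℝ) : Fin n → ℝ :=
  fun i => w i - a * (deriv (ft i) (w i) + v i + b / 2 * disagreement G W w i)

/-- The pair `(w^t, v^t)` of EXTRA with step sizes `a`, `b`, started at `w⁰ = w0` and `v⁰ = 0`. -/
def extra {n : ℕ} (G : SimpleGraph (Fin n)) (W : Matrix (Fin n) (Fin n) ℝ)
    (ft : Fin n → ℝ → ℝ) (a b : ℝ) (w0 : Fin n → ℝ) : ℕ → (Fin n → ℝ) × (Fin n → ℝ)
  | 0 => (w0, 0)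
  | t + 1 =>
    let w := (extra G W ft a b w0 t).1
    let v := (extra G W ft a b w0 t).2
    let w' := primalStep G W ft a b w v
    (w', fun i => v i + b / 2 * disagreement G W w' i)

/-- The running average `(1 / T) ∑_{t=1}^T w_i^t`. -/
def runningAverage {n : ℕ} (G : SimpleGraph (Fin n)) (W : Matrix (Fin n) (Fin n) ℝ)
    (ft : Fin n → ℝ → ℝ) (a b : ℝ) (w0 : Fin n → ℝ) (T : ℕ) (i : Fin n) : ℝ :=
  1 / (T : ℝ) * ∑ t ∈ Finset.Icc 1 T, (extra G W ft a b w0 t).1 i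

end TopK

end

/-!
The quantile objective `f = ∑ i, f i` is minimized at `θ_k`, and counting the scores on either side
of `θ_k` gives its one-sided slopes there, so that `g_m |x - θ_k| ≤ f x - f θ_k` for all `x`
(`multParam_mul_abs_le`). It therefore suffices that every agent's running average has objective gap
less than `g_m Δ / 2`. Replacing `f` by its smooth approximation costs `2 U ≤ g_m Δ / 4`, which
leaves `g_m Δ / 4` for the error of EXTRA on the approximation.

With `K = (1 - W) / 2`, EXTRA is the linearized augmented Lagrangian method for minimizing
`∑ i, ft i (w i)` subject to `K w = 0`: its second variable is `v = K y` with `y` the accumulated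
iterates times `β`. Since `0 ≤ K ≤ 1`, a telescoping potential bounds the accumulated Lagrangian gap
for every dual reference point `q` by `(M / n + β) ‖w⁰ - θ 1‖² + ⟪q, K q⟫ / (2 β)`
(`sum_primal_dual_gap_le`). On the orthogonal complement of the constant vectors `K` is at least
`(1 - σ₂) / 2`, because `σ₂ < 1` bounds the norm of `W` there (`singularValues_one_of_contracting`),
so `K q` can be any vector `v` with zero sum, at energy at most `2 ‖v‖² / (1 - σ₂)`
(`exists_halfLaplacian_eq`).

The vector `v` is chosen as minus the centred gradient at the mean `m` of the agents' running
averages, plus `c` times the unit vector along the deviation `D` of these averages from `m`. This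
turns the gap bound into a bound on the objective gap at `m` plus `c ‖D‖` (`consensus_gap_le`). The
gradient is bounded by `√(n R₂)`, since a convex function at bounded distance from the pinball loss
has its slopes in `[-p, 1 - p]` (`deriv_mem_Icc_of_abs_pinball_sub_le`). The choice `c = 0` controls
the objective at `m`, a balanced `c` controls `‖D‖`, and the Lipschitz constant `L` passes from `m`
to each agent (`gap_add_mul_dist_lt`).
-/

namespace TopK

/-! ### Growth of the quantile objective -/

section Scores

variable {n k : ℕ} (s : Fin n → ℝ) (hk : 1 ≤ k ∧ k ≤ n)

lemma sortedScores_antitone {i j : Fin n} (hij : i ≤ j) :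
    sortedScores s j ≤ sortedScores s i := by
  have h := Tuple.monotone_sort (fun i => -s i) hij
  simp only [Function.comp] at h
  unfold sortedScores
  linarith

open scoped Classical in
lemma card_filter_sortedScores (P : ℝ → Prop) :
    (Finset.univ.filter fun j : Fin n => P (sortedScores s j)).card =
      (Finset.univ.filter fun i : Fin n => P (s i)).card :=
  Finset.card_equiv (Tuple.sort fun i => -s i) fun i => by
    rw [Finset.mem_filter, Finset.mem_filter]
    simp [sortedScores]

open scoped Classical in
/-- Among the `k` largest scores, those that are not strictly larger than `θ_k` equal it. -/
lemma upperMult_add_card_gt :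
    upperMult s k hk + (Finset.univ.filter fun i => kthLargest s k hk < s i).card = k := by
  rw [← card_filter_sortedScores s fun x => kthLargest s k hk < x, upperMult,
    ← Finset.card_union_of_disjoint]
  · have h : (Finset.univ.filter fun j : Fin n =>
        sortedScores s j = kthLargest s k hk ∧ (j : ℕ) + 1 ≤ k) ∪
        (Finset.univ.filter fun j : Fin n => kthLargest s k hk < sortedScores s j) =
        Finset.univ.filter fun j : Fin n => (j : ℕ) < k := by
      ext j
      simp only [Finset.mem_union, Finset.mem_filter, Finset.mem_univ, true_and]
      constructor
      · rintro (⟨-, h⟩ | h)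
        · omega
        · by_contra hj
          exact absurd (sortedScores_antitone s
            (show (⟨k - 1, by omega⟩ : Fin n) ≤ j from Fin.le_def.2 (by simp; omega))) (not_le.2 h)
      · intro hj
        have : kthLargest s k hk ≤ sortedScores s j :=
          sortedScores_antitone s (Fin.le_def.2 (by simp; omega))
        rcases this.eq_or_lt with h | h
        · exact Or.inl ⟨h.symm, hj⟩
        · exact Or.inr h
    rw [h, Fin.card_filter_val_lt, min_eq_right hk.2]
  · rw [Finset.disjoint_filter]
    rintro j - ⟨h, -⟩ h'
    exact h'.ne' h

open scoped Classical in
/-- Among the `n - k` smallest scores, those that are not strictly smaller than `θ_k` equal it. -/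
lemma lowerMult_add_card_lt :
    lowerMult s k hk + (Finset.univ.filter fun i => s i < kthLargest s k hk).card + k = n := by
  have hsplit : (Finset.univ.filter fun j : Fin n => k < (j : ℕ) + 1).card + k = n := by
    have := Finset.card_filter_add_card_filter_not (s := (Finset.univ : Finset (Fin n)))
      (fun j : Fin n => (j : ℕ) < k)
    rw [Fin.card_filter_val_lt, min_eq_right hk.2, Finset.card_univ, Fintype.card_fin] at this
    simp only [not_lt] at this
    simp only [Nat.lt_succ_iff]
    omega
  rw [← card_filter_sortedScores s fun x => x < kthLargest s k hk, lowerMult,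
    ← Finset.card_union_of_disjoint]
  · have h : (Finset.univ.filter fun j : Fin n =>
        sortedScores s j = kthLargest s k hk ∧ k < (j : ℕ) + 1) ∪
        (Finset.univ.filter fun j : Fin n => sortedScores s j < kthLargest s k hk) =
        Finset.univ.filter fun j : Fin n => k < (j : ℕ) + 1 := by
      ext j
      simp only [Finset.mem_union, Finset.mem_filter, Finset.mem_univ, true_and]
      constructor
      · rintro (⟨-, h⟩ | h)
        · omega
        · by_contra hj
          exact absurd (sortedScores_antitone s
            (show j ≤ (⟨k - 1, by omega⟩ : Fin n) from Fin.le_def.2 (by simp; omega))) (not_le.2 h)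
      · intro hj
        have : sortedScores s j ≤ kthLargest s k hk :=
          sortedScores_antitone s (Fin.le_def.2 (by simp; omega))
        rcases this.eq_or_lt with h | h
        · exact Or.inl ⟨h, hj⟩
        · exact Or.inr h
    rw [h, hsplit]
  · rw [Finset.disjoint_filter]
    rintro j - ⟨h, -⟩ h'
    exact h'.ne h

lemma one_le_upperMult : 1 ≤ upperMult s k hk := by
  classical
  refine Finset.card_pos.2 ⟨⟨k - 1, by omega⟩, ?_⟩
  simp only [Finset.mem_filter, Finset.mem_univ, true_and]
  exact ⟨rfl, by omega⟩

lemma multParam_pos : 0 < multParam s k hk := by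
  have : (1 : ℝ) ≤ upperMult s k hk := by exact_mod_cast one_le_upperMult s hk
  unfold multParam
  exact lt_min (by linarith) (by positivity)

lemma minGap_pos (hs : ∃ i, s i ≠ kthLargest s k hk) : 0 < minGap s k hk := by
  have hfin : {d : ℝ | ∃ i, s i ≠ kthLargest s k hk ∧ d = |s i - kthLargest s k hk|}.Finite :=
    (Set.finite_range fun i => |s i - kthLargest s k hk|).subset
      (by rintro d ⟨i, -, rfl⟩; exact ⟨i, rfl⟩)
  obtain ⟨i, hi⟩ := hs
  have hne : {d : ℝ | ∃ i, s i ≠ kthLargest s k hk ∧ d = |s i - kthLargest s k hk|}.Nonempty :=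
    ⟨_, i, hi, rfl⟩
  obtain ⟨j, hj, h⟩ := hne.csInf_mem hfin
  unfold minGap
  rw [h]
  exact abs_pos.2 (sub_ne_zero.2 hj)

include hk in
lemma quantileLevel_mem : 0 < quantileLevel n k ∧ quantileLevel n k < 1 := by
  have hn : (0 : ℝ) < n := by exact_mod_cast (by omega : 0 < n)
  have h1 : (1 : ℝ) ≤ k := by exact_mod_cast hk.1
  have h2 : (k : ℝ) ≤ n := by exact_mod_cast hk.2
  have e : quantileLevel n k = (n - k + 1 / 2) / n := by
    unfold quantileLevel; field_simp
  rw [e, lt_div_iff₀ hn, div_lt_iff₀ hn]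
  constructor <;> linarith

end Scores

/-- A subgradient inequality at `x`, in the direction of larger arguments. -/
lemma pinball_sub_ge_right (p a : ℝ) {x y : ℝ} (hxy : x ≤ y) :
    pinball p (a - y) - pinball p (a - x) ≥ ((if a ≤ x then 1 else 0) - p) * (y - x) := by
  unfold pinball
  split_ifs <;> nlinarith

/-- A subgradient inequality at `x`, in the direction of smaller arguments. -/
lemma pinball_sub_ge_left (p a : ℝ) {x y : ℝ} (hxy : y ≤ x) :
    pinball p (a - y) - pinball p (a - x) ≥ (p - if a < x then 1 else 0) * (x - y) := by
  unfold pinball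
  split_ifs <;> nlinarith

/-- The quantile objective grows linearly away from `θ_k`: its one-sided slopes there are
`upperMult - 1/2` to the right and `lowerMult + 1/2` to the left. -/
lemma multParam_mul_abs_le {n k : ℕ} (s : Fin n → ℝ) (hk : 1 ≤ k ∧ k ≤ n) (x : ℝ) :
    multParam s k hk * |x - kthLargest s k hk| ≤
      ∑ i, localLoss (quantileLevel n k) s i x -
        ∑ i, localLoss (quantileLevel n k) s i (kthLargest s k hk) := by
  classical
  set θ := kthLargest s k hk with hθ
  have hn : (0 : ℝ) < n := by exact_mod_cast (by omega : 0 < n)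
  have hp : n * quantileLevel n k = n - k + 1 / 2 := by
    unfold quantileLevel; field_simp
  rw [← Finset.sum_sub_distrib]
  rcases le_total θ x with hx | hx
  · have hcard : (∑ i, if s i ≤ θ then (1 : ℝ) else 0) = n - k + upperMult s k hk := by
      have h1 := upperMult_add_card_gt s hk
      have h2 := Finset.card_filter_add_card_filter_not (s := (Finset.univ : Finset (Fin n)))
        (fun i => s i ≤ θ)
      simp only [not_le, Finset.card_univ, Fintype.card_fin] at h2
      rw [Finset.sum_boole]
      have h1' : (upperMult s k hk : ℝ) + (Finset.univ.filter fun i => θ < s i).card = k := by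
        exact_mod_cast h1
      have h2' : ((Finset.univ.filter fun i => s i ≤ θ).card : ℝ) +
          (Finset.univ.filter fun i => θ < s i).card = n := by exact_mod_cast h2
      linarith
    have hsum : ∑ i, ((if s i ≤ θ then (1 : ℝ) else 0) - quantileLevel n k) * (x - θ) =
        (upperMult s k hk - 1 / 2) * (x - θ) := by
      rw [← Finset.sum_mul, Finset.sum_sub_distrib, hcard, Finset.sum_const, Finset.card_univ,
        Fintype.card_fin, nsmul_eq_mul, hp]
      ring
    calc multParam s k hk * |x - θ| ≤ (upperMult s k hk - 1 / 2) * (x - θ) := by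
          rw [abs_of_nonneg (sub_nonneg.2 hx)]
          exact mul_le_mul_of_nonneg_right (min_le_left _ _) (sub_nonneg.2 hx)
      _ ≤ _ := by
          rw [← hsum]
          exact Finset.sum_le_sum fun i _ => pinball_sub_ge_right _ _ hx
  · have hcard : (∑ i, if s i < θ then (1 : ℝ) else 0) = n - k - lowerMult s k hk := by
      have h1' : (lowerMult s k hk : ℝ) + (Finset.univ.filter fun i => s i < θ).card + k = n := by
        exact_mod_cast lowerMult_add_card_lt s hk
      rw [Finset.sum_boole]
      linarith
    have hsum : ∑ i, (quantileLevel n k - if s i < θ then (1 : ℝ) else 0) * (θ - x) =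
        (lowerMult s k hk + 1 / 2) * (θ - x) := by
      rw [← Finset.sum_mul, Finset.sum_sub_distrib, hcard, Finset.sum_const, Finset.card_univ,
        Fintype.card_fin, nsmul_eq_mul, hp]
      ring
    calc multParam s k hk * |x - θ| ≤ (lowerMult s k hk + 1 / 2) * (θ - x) := by
          rw [abs_of_nonpos (sub_nonpos.2 hx), neg_sub]
          exact mul_le_mul_of_nonneg_right (min_le_right _ _) (sub_nonneg.2 hx)
      _ ≤ _ := by
          rw [← hsum]
          exact Finset.sum_le_sum fun i _ => pinball_sub_ge_left _ _ hx

/-! ### Convex smooth approximations -/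

section Smoothing

lemma deriv_mul_sub_le {f : ℝ → ℝ} (hc : ConvexOn ℝ Set.univ f) (hd : Differentiable ℝ f)
    (x y : ℝ) : deriv f x * (y - x) ≤ f y - f x := by
  rcases lt_trichotomy x y with h | rfl | h
  · have := hc.deriv_le_slope (Set.mem_univ x) (Set.mem_univ y) h (hd x)
    rwa [slope_def_field, le_div_iff₀ (sub_pos.2 h)] at this
  · simp
  · have := hc.slope_le_deriv (Set.mem_univ y) (Set.mem_univ x) h (hd x)
    rw [slope_def_field, div_le_iff₀ (sub_pos.2 h)] at this
    linarith

/-- The three-point inequality of gradient descent: the gradient at `x` bounds `f y - f z` up to an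
error quadratic in `y - x`. The constant `l` in place of `l / 2` avoids an integration and is small
enough for the step size of EXTRA. -/
lemma sub_le_deriv_mul_add {f : ℝ → ℝ} (hc : ConvexOn ℝ Set.univ f) (hd : Differentiable ℝ f)
    {l : ℝ} (hl : ∀ x y, |deriv f x - deriv f y| ≤ l * |x - y|) (x y z : ℝ) :
    f y - f z ≤ deriv f x * (y - z) + l * (y - x) ^ 2 := by
  have h1 := deriv_mul_sub_le hc hd x z
  have h2 := deriv_mul_sub_le hc hd y x
  have h3 : (deriv f y - deriv f x) * (y - x) ≤ l * (y - x) ^ 2 := by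
    calc _ ≤ |deriv f y - deriv f x| * |y - x| := by rw [← abs_mul]; exact le_abs_self _
      _ ≤ l * |y - x| * |y - x| := mul_le_mul_of_nonneg_right (hl y x) (abs_nonneg _)
      _ = l * (y - x) ^ 2 := by rw [mul_assoc, abs_mul_abs_self]; ring
  linarith

/-- A convex function at bounded distance from a pinball loss has its slopes between the two
asymptotic slopes of that loss. -/
lemma deriv_mem_Icc_of_abs_pinball_sub_le {f : ℝ → ℝ} (hc : ConvexOn ℝ Set.univ f)
    (hd : Differentiable ℝ f) {p a C : ℝ} (hC : ∀ x, |pinball p (a - x) - f x| ≤ C) (x₀ : ℝ) :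
    deriv f x₀ ∈ Set.Icc (-p) (1 - p) := by
  set d := deriv f x₀ with hdef
  have key : ∀ x, d * (x - x₀) ≤ pinball p (a - x) + C - f x₀ := fun x => by
    have h1 := deriv_mul_sub_le hc hd x₀ x
    have h2 := (abs_le.1 (hC x)).1
    linarith
  constructor
  · by_contra! h
    have hlt : d + p < 0 := by linarith
    set B := p * a + C - f x₀ + d * x₀ with hB
    have h1 : ∀ x ≤ a, (d + p) * x ≤ B := fun x hx => by
      have := key x
      rw [pinball, if_pos (sub_nonneg.2 hx)] at this
      rw [hB]; linarith
    have h2 := h1 (min a ((B + 1) / (d + p))) (min_le_left _ _)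
    have h3 := mul_le_mul_of_nonpos_left (min_le_right a ((B + 1) / (d + p))) hlt.le
    rw [mul_div_cancel₀ _ hlt.ne] at h3
    linarith
  · by_contra! h
    have hlt : 0 < d - (1 - p) := by linarith
    set B := -(1 - p) * a + C - f x₀ + d * x₀ with hB
    have h1 : ∀ x, a < x → (d - (1 - p)) * x ≤ B := fun x hx => by
      have := key x
      rw [pinball, if_neg (by linarith)] at this
      rw [hB]; linarith
    have h2 := h1 (max (a + 1) ((B + 1) / (d - (1 - p))))
      (lt_of_lt_of_le (by linarith) (le_max_left _ _))
    have h3 := mul_le_mul_of_nonneg_left (le_max_right (a + 1) ((B + 1) / (d - (1 - p)))) hlt.le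
    rw [mul_div_cancel₀ _ hlt.ne'] at h3
    linarith

lemma sq_le_max_sq_of_mem_Icc {p d : ℝ} (hd : d ∈ Set.Icc (-p) (1 - p)) :
    d ^ 2 ≤ max (p ^ 2) ((1 - p) ^ 2) := by
  rcases le_total 0 d with h | h
  · exact le_max_of_le_right (pow_le_pow_left₀ h hd.2 2)
  · exact le_max_of_le_left (by nlinarith [hd.1])

/-- The smoothness constant is positive: a constant derivative that vanishes at the minimizer
would make the approximation constant, whereas the quantile objective is unbounded. -/
lemma IsSmoothApprox.smoothness_pos {n k : ℕ} {s : Fin n → ℝ} (hk : 1 ≤ k ∧ k ≤ n)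
    {ft : Fin n → ℝ → ℝ} {L M U : ℝ}
    (hft : IsSmoothApprox (localLoss (quantileLevel n k) s) ft L M U)
    {θh : ℝ} (hθh : ∀ x, ∑ i, ft i θh ≤ ∑ i, ft i x) : 0 < M := by
  by_contra! hM
  have hdiff : Differentiable ℝ fun z => ∑ i, ft i z :=
    Differentiable.fun_sum fun i _ => hft.differentiable i
  have h0 : deriv (fun z => ∑ i, ft i z) θh = 0 :=
    IsLocalMin.deriv_eq_zero (Filter.Eventually.of_forall hθh)
  have hder : ∀ x, deriv (fun z => ∑ i, ft i z) x = 0 := fun x => by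
    have := hft.smooth x θh
    rw [h0, sub_zero] at this
    exact abs_nonpos_iff.1
      (this.trans (mul_nonpos_of_nonpos_of_nonneg hM (abs_nonneg _)))
  have hconst : ∀ x, ∑ i, ft i x = ∑ i, ft i θh := fun x =>
    is_const_of_deriv_eq_zero hdiff hder x θh
  set θ := kthLargest s k hk with hθ
  have hg := multParam_pos s hk
  have hU : 0 ≤ U := (abs_nonneg _).trans (hft.error θ)
  set x := θ + (2 * U + 1) / multParam s k hk with hx
  have h1 := multParam_mul_abs_le s hk x
  have h2 := (abs_le.1 (hft.error x)).2
  have h3 := (abs_le.1 (hft.error θ)).1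
  rw [← hθ, hx, add_sub_cancel_left, abs_of_nonneg (by positivity), mul_div_cancel₀ _ hg.ne'] at h1
  rw [hconst] at h2 h3
  linarith

end Smoothing

/-! ### Spectral estimates for the weight matrix -/

section Spectral

open Module Module.End
open scoped InnerProductSpace

variable {E : Type*} [NormedAddCommGroup E] [InnerProductSpace ℝ E]

lemma exists_inner_orthonormalBasis_ne_zero {ι : Type*} [Fintype ι] (b : OrthonormalBasis ι ℝ E)
    {x : E} (hx : x ≠ 0) : ∃ i, ⟪b i, x⟫_ℝ ≠ 0 := by
  by_contra! h
  have := b.sum_sq_norm_inner_right x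
  simp only [h, norm_zero] at this
  exact hx (by simpa [eq_comm] using this)

lemma norm_map_lt_of_hasEigenvalue_abs_lt_one [FiniteDimensional ℝ E] {A : E →ₗ[ℝ] E}
    (hA : A.IsSymmetric) (h : ∀ μ : ℝ, HasEigenvalue A μ → |μ| < 1) {x : E} (hx : x ≠ 0) :
    ‖A x‖ < ‖x‖ := by
  set b := hA.eigenvectorBasis rfl with hb
  have hAb : ∀ i, ⟪b i, A x⟫_ℝ = hA.eigenvalues rfl i * ⟪b i, x⟫_ℝ := fun i => by
    rw [← hA, hb, hA.apply_eigenvectorBasis, inner_smul_left]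
    simp
  have hμ : ∀ i, |hA.eigenvalues rfl i| < 1 := fun i => h _ (hA.hasEigenvalue_eigenvalues rfl i)
  have hle : ∀ i, ‖⟪b i, A x⟫_ℝ‖ ^ 2 ≤ ‖⟪b i, x⟫_ℝ‖ ^ 2 := fun i => by
    rw [hAb, norm_mul, mul_pow]
    exact mul_le_of_le_one_left (by positivity) (pow_le_one₀ (norm_nonneg _) (hμ i).le)
  refine lt_of_pow_lt_pow_left₀ 2 (norm_nonneg _) ?_
  rw [← b.sum_sq_norm_inner_right x, ← b.sum_sq_norm_inner_right (A x)]
  obtain ⟨i, hi⟩ := exists_inner_orthonormalBasis_ne_zero b hx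
  refine Finset.sum_lt_sum (fun i _ => hle i) ⟨i, Finset.mem_univ i, ?_⟩
  rw [hAb, norm_mul, mul_pow]
  exact mul_lt_of_lt_one_left (by positivity)
    (pow_lt_one₀ (norm_nonneg _) (hμ i) two_ne_zero)

/-- If a symmetric operator fixes `e` and strictly contracts the vectors orthogonal to `e`, then
`e` spans the top singular space, so the second singular value is smaller than one and bounds the
operator on the orthogonal complement of `e`. -/
lemma singularValues_one_of_contracting [FiniteDimensional ℝ E] {A : E →ₗ[ℝ] E}
    (hA : A.IsSymmetric) {e : E} (he : e ≠ 0) (hAe : A e = e)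
    (hlt : ∀ x, ⟪e, x⟫_ℝ = 0 → x ≠ 0 → ‖A x‖ < ‖x‖) (hdim : 1 < finrank ℝ E) :
    A.singularValues 1 < 1 ∧ ∀ x, ⟪e, x⟫_ℝ = 0 → ‖A x‖ ≤ A.singularValues 1 * ‖x‖ := by
  have hS := A.isSymmetric_adjoint_comp_self
  set b := hS.eigenvectorBasis rfl with hb
  set μ := hS.eigenvalues rfl with hμ
  have hanti : Antitone μ := hS.eigenvalues_antitone rfl
  have hSb : ∀ i, (A.adjoint ∘ₗ A) (b i) = μ i • b i := fun i => hS.apply_eigenvectorBasis rfl i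
  have hSe : (A.adjoint ∘ₗ A) e = e := by
    rw [LinearMap.comp_apply, hAe, hA.adjoint_eq, hAe]
  have hSbx : ∀ i x, ⟪b i, (A.adjoint ∘ₗ A) x⟫_ℝ = μ i * ⟪b i, x⟫_ℝ := fun i x => by
    rw [← hS, hSb, inner_smul_left]
    simp
  have hnorm : ∀ x, ‖A x‖ ^ 2 = ∑ i, μ i * ⟪b i, x⟫_ℝ ^ 2 := fun x => by
    rw [← real_inner_self_eq_norm_sq, ← LinearMap.adjoint_inner_right, ← LinearMap.comp_apply,
      ← b.sum_inner_mul_inner]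
    refine Finset.sum_congr rfl fun i _ => ?_
    rw [hSbx, real_inner_comm]
    ring
  have hnorm' : ∀ x, ‖x‖ ^ 2 = ∑ i, ⟪b i, x⟫_ℝ ^ 2 := fun x => by
    rw [← b.sum_sq_norm_inner_right x]
    simp
  have heig : ∀ i, (μ i - 1) * ⟪b i, e⟫_ℝ = 0 := fun i => by
    have := hSbx i e
    rw [hSe] at this
    linarith
  obtain ⟨i₀, hi₀⟩ := exists_inner_orthonormalBasis_ne_zero b he
  have hμ₀ : μ i₀ = 1 := by
    rcases mul_eq_zero.1 (heig i₀) with h | h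
    · linarith
    · exact absurd h hi₀
  have hbb : ∀ i j, ⟪b i, b j⟫_ℝ = if i = j then 1 else 0 := fun i j =>
    orthonormal_iff_ite.1 b.orthonormal i j
  -- The combination of `b j` and `b i₀` that is orthogonal to `e` is contracted.
  have hother : ∀ j, j ≠ i₀ → μ j < 1 := fun j hj => by
    set c := ⟪b j, e⟫_ℝ / ⟪b i₀, e⟫_ℝ with hc
    set y := b j - c • b i₀ with hy
    have hyb : ∀ i, ⟪b i, y⟫_ℝ = (if i = j then 1 else 0) - c * if i = i₀ then 1 else 0 :=
      fun i => by rw [hy, inner_sub_right, inner_smul_right, hbb, hbb]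
    have hye : ⟪e, y⟫_ℝ = 0 := by
      rw [hy, inner_sub_right, inner_smul_right, real_inner_comm (b j) e,
        real_inner_comm (b i₀) e, hc,
        div_mul_cancel₀ _ hi₀, sub_self]
    have hy0 : y ≠ 0 := fun h => by
      have := hyb j
      rw [h, inner_zero_right, if_pos rfl, if_neg hj] at this
      norm_num at this
    have h := pow_lt_pow_left₀ (hlt y hye hy0) (norm_nonneg _) two_ne_zero
    have hsum : ∀ ν : Fin (finrank ℝ E) → ℝ,
        ∑ i, ν i * ⟪b i, y⟫_ℝ ^ 2 = ν j + ν i₀ * c ^ 2 := fun ν => by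
      have : ∀ i, ν i * ⟪b i, y⟫_ℝ ^ 2 =
          (if i = j then ν j else 0) + if i = i₀ then ν i₀ * c ^ 2 else 0 := fun i => by
        rw [hyb]
        by_cases h1 : i = j
        · subst h1; simp [hj]
        · by_cases h2 : i = i₀
          · subst h2; simp [h1]
          · simp [h1, h2]
      simp [this, Finset.sum_add_distrib]
    have h2 := hsum fun _ => 1
    simp only [one_mul] at h2
    rw [hnorm, hnorm', hsum, h2, hμ₀] at h
    linarith
  have hi₀0 : i₀ = ⟨0, by omega⟩ := by
    by_contra hne
    have h1 := hother ⟨0, by omega⟩ (Ne.symm hne)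
    have h2 : μ i₀ ≤ μ ⟨0, by omega⟩ := hanti (Fin.le_def.2 (Nat.zero_le _))
    linarith
  have hsq : A.singularValues 1 ^ 2 = μ ⟨1, hdim⟩ := A.sq_singularValues_of_lt rfl hdim
  have h0 := A.singularValues_nonneg 1
  refine ⟨?_, fun x hx => ?_⟩
  · have := hother ⟨1, hdim⟩ (by rw [hi₀0]; simp)
    nlinarith
  · have hx0 : ⟪b i₀, x⟫_ℝ = 0 := by
      have h := b.sum_inner_mul_inner e x
      rw [hx, Finset.sum_eq_single i₀] at h
      · rcases mul_eq_zero.1 h with h | h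
        · exact absurd (by rw [real_inner_comm]; exact h) hi₀
        · exact h
      · intro j _ hj
        have h1 : μ j - 1 ≠ 0 := by linarith [hother j hj]
        rw [real_inner_comm, (mul_eq_zero.1 (heig j)).resolve_left h1, zero_mul]
      · simp
    refine le_of_sq_le_sq ?_ (by positivity)
    rw [mul_pow, hnorm, hnorm', hsq, Finset.mul_sum]
    refine Finset.sum_le_sum fun i _ => ?_
    by_cases hi : i = i₀
    · simp [hi, hx0]
    · refine mul_le_mul_of_nonneg_right (hanti (Fin.le_def.2 ?_)) (sq_nonneg _)
      rw [hi₀0] at hi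
      have : (i : ℕ) ≠ 0 := fun h => hi (Fin.ext h)
      simp; omega

/-- The operator `(1 - A) / 2`, which for a symmetric contraction `A` lies between `0` and `1`. -/
noncomputable def halfLaplacian (A : E →ₗ[ℝ] E) : E →ₗ[ℝ] E :=
  (1 / 2 : ℝ) • (LinearMap.id - A)

lemma halfLaplacian_apply (A : E →ₗ[ℝ] E) (x : E) :
    halfLaplacian A x = (1 / 2 : ℝ) • (x - A x) := rfl

lemma isSymmetric_halfLaplacian {A : E →ₗ[ℝ] E} (hA : A.IsSymmetric) :
    (halfLaplacian A).IsSymmetric :=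
  (LinearMap.IsSymmetric.id.sub hA).smul (by simp)

lemma inner_halfLaplacian (A : E →ₗ[ℝ] E) (x : E) :
    ⟪x, halfLaplacian A x⟫_ℝ = (‖x‖ ^ 2 - ⟪x, A x⟫_ℝ) / 2 := by
  rw [halfLaplacian_apply, inner_smul_right, inner_sub_right, real_inner_self_eq_norm_sq]
  ring

lemma norm_map_le_of_contracting {A : E →ₗ[ℝ] E} (hA : A.IsSymmetric) {e : E}
    (hAe : A e = e) {σ : ℝ} (hσ : σ ≤ 1) (hle : ∀ x, ⟪e, x⟫_ℝ = 0 → ‖A x‖ ≤ σ * ‖x‖) (x : E) :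
    ‖A x‖ ≤ ‖x‖ := by
  obtain ⟨c, z, hz, rfl⟩ : ∃ (c : ℝ) (z : E), ⟪e, z⟫_ℝ = 0 ∧ c • e + z = x := by
    refine ⟨⟪e, x⟫_ℝ / ‖e‖ ^ 2, x - (⟪e, x⟫_ℝ / ‖e‖ ^ 2) • e, ?_, by abel⟩
    rcases eq_or_ne e 0 with rfl | he
    · simp
    · rw [inner_sub_right, inner_smul_right, real_inner_self_eq_norm_sq,
        div_mul_cancel₀ _ (by simpa using he), sub_self]
  have hAz : ⟪e, A z⟫_ℝ = 0 := by rw [← hA, hAe, hz]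
  refine le_of_sq_le_sq ?_ (norm_nonneg _)
  rw [map_add, map_smul, hAe, norm_add_sq_real, norm_add_sq_real, inner_smul_left, inner_smul_left,
    hz, hAz]
  have h1 : ‖A z‖ ≤ ‖z‖ := (hle z hz).trans (mul_le_of_le_one_left (norm_nonneg _) hσ)
  have := pow_le_pow_left₀ (norm_nonneg _) h1 2
  linarith

lemma inner_halfLaplacian_mem_Icc {A : E →ₗ[ℝ] E} (hle : ∀ x, ‖A x‖ ≤ ‖x‖) (x : E) :
    ⟪x, halfLaplacian A x⟫_ℝ ∈ Set.Icc 0 (‖x‖ ^ 2) := by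
  have h := abs_le.1 (abs_real_inner_le_norm x (A x))
  have h2 := mul_le_mul_of_nonneg_left (hle x) (norm_nonneg x)
  rw [inner_halfLaplacian]
  constructor <;> nlinarith

/-- Every vector orthogonal to `e` has a preimage under the half Laplacian whose energy is
controlled by the spectral gap. -/
lemma exists_halfLaplacian_eq [FiniteDimensional ℝ E] {A : E →ₗ[ℝ] E} (hA : A.IsSymmetric)
    {e : E} (he : e ≠ 0) (hAe : A e = e) {σ : ℝ} (hσ : σ < 1)
    (hle : ∀ x, ⟪e, x⟫_ℝ = 0 → ‖A x‖ ≤ σ * ‖x‖)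
    {v : E} (hv : ⟪e, v⟫_ℝ = 0) :
    ∃ q, halfLaplacian A q = v ∧ ⟪q, halfLaplacian A q⟫_ℝ ≤ 2 / (1 - σ) * ‖v‖ ^ 2 := by
  have hKe : ∀ x, ⟪e, halfLaplacian A x⟫_ℝ = 0 := fun x => by
    rw [← isSymmetric_halfLaplacian hA, halfLaplacian_apply, hAe, sub_self, smul_zero,
      inner_zero_left]
  have hgap : ∀ x, ⟪e, x⟫_ℝ = 0 → (1 - σ) / 2 * ‖x‖ ^ 2 ≤ ⟪x, halfLaplacian A x⟫_ℝ :=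
    fun x hx => by
      have h1 := (abs_le.1 (abs_real_inner_le_norm x (A x))).2
      have h2 := mul_le_mul_of_nonneg_left (hle x hx) (norm_nonneg x)
      rw [inner_halfLaplacian]
      nlinarith
  -- Adding a multiple of the projection onto `e` to the half Laplacian makes it invertible.
  set N : E →ₗ[ℝ] E := halfLaplacian A + (innerₛₗ ℝ e).smulRight e with hN
  have hNx : ∀ x, N x = halfLaplacian A x + ⟪e, x⟫_ℝ • e := fun x => by simp [hN]
  have he2 : ‖e‖ ^ 2 ≠ 0 := by simpa using he
  have hNe : ∀ x, ⟪e, N x⟫_ℝ = 0 → ⟪e, x⟫_ℝ = 0 := fun x hx => by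
    rw [hNx, inner_add_right, hKe, zero_add, inner_smul_right, real_inner_self_eq_norm_sq] at hx
    exact (mul_eq_zero.1 hx).resolve_right he2
  have hinj : Function.Injective N := by
    rw [← LinearMap.ker_eq_bot, LinearMap.ker_eq_bot']
    intro x hx
    have hex := hNe x (by rw [hx, inner_zero_right])
    rw [hNx, hex, zero_smul, add_zero] at hx
    have h := hgap x hex
    rw [hx, inner_zero_right] at h
    have : ‖x‖ ^ 2 ≤ 0 := by
      by_contra! h'
      have : 0 < (1 - σ) / 2 * ‖x‖ ^ 2 := mul_pos (by linarith) h'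
      linarith
    exact norm_eq_zero.1 (pow_eq_zero_iff two_ne_zero |>.1 (le_antisymm this (by positivity)))
  obtain ⟨q, hq⟩ := LinearMap.injective_iff_surjective.1 hinj v
  have heq := hNe q (by rw [hq, hv])
  rw [hNx, heq, zero_smul, add_zero] at hq
  refine ⟨q, hq, ?_⟩
  have h1 := hgap q heq
  have h2 := real_inner_le_norm q v
  rw [hq] at h1 ⊢
  have hσ' : 0 < 1 - σ := by linarith
  have h3 : (1 - σ) / 2 * ‖q‖ ≤ ‖v‖ := by
    rcases (norm_nonneg q).eq_or_lt with h | h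
    · rw [← h, mul_zero]; exact norm_nonneg v
    · refine le_of_mul_le_mul_right ?_ h
      nlinarith
  calc ⟪q, v⟫_ℝ ≤ ‖q‖ * ‖v‖ := h2
    _ = 2 / (1 - σ) * (((1 - σ) / 2 * ‖q‖) * ‖v‖) := by field_simp
    _ ≤ 2 / (1 - σ) * (‖v‖ * ‖v‖) := by gcongr
    _ = 2 / (1 - σ) * ‖v‖ ^ 2 := by ring

end Spectral

section WeightMatrix

open scoped InnerProductSpace

variable {n : ℕ}

/-- The vector with all entries one. -/
def ones (n : ℕ) : EuclideanSpace ℝ (Fin n) := WithLp.toLp 2 fun _ => 1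

lemma inner_ones (x : EuclideanSpace ℝ (Fin n)) : ⟪ones n, x⟫_ℝ = ∑ i, x i := by
  simp [PiLp.inner_apply, ones]

lemma ones_ne_zero (hn : 0 < n) : ones n ≠ 0 := fun h => by
  have : (ones n) ⟨0, hn⟩ = (0 : EuclideanSpace ℝ (Fin n)) ⟨0, hn⟩ := by rw [h]
  simp [ones] at this

lemma toEuclideanLin_apply_apply (W : Matrix (Fin n) (Fin n) ℝ) (x : EuclideanSpace ℝ (Fin n))
    (i : Fin n) : Matrix.toEuclideanLin W x i = ∑ j, W i j * x j := rfl

variable {G : SimpleGraph (Fin n)} {W : Matrix (Fin n) (Fin n) ℝ}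

lemma IsWeightMatrix.isSymmetric (hW : IsWeightMatrix G W) :
    (Matrix.toEuclideanLin W).IsSymmetric :=
  Matrix.isSymmetric_toEuclideanLin_iff.2 (Matrix.isHermitian_iff_isSymm.2 hW.symm)

lemma IsWeightMatrix.map_ones (hW : IsWeightMatrix G W) :
    Matrix.toEuclideanLin W (ones n) = ones n := by
  ext i
  rw [toEuclideanLin_apply_apply]
  simp [ones, hW.row_sum]

/-- On the orthogonal complement of `ones n` the matrices `W` and `W - (1/n) 1 1ᵀ` agree, and the
latter is a strict contraction. -/
lemma IsWeightMatrix.sigmaTwo_spec (hW : IsWeightMatrix G W) (hn : 1 < n) :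
    sigmaTwo W < 1 ∧
      ∀ x, ⟪ones n, x⟫_ℝ = 0 → ‖Matrix.toEuclideanLin W x‖ ≤ sigmaTwo W * ‖x‖ := by
  set J : Matrix (Fin n) (Fin n) ℝ := Matrix.of fun _ _ => 1 / (n : ℝ) with hJ
  have hJs : J.IsSymm := by ext i j; simp [hJ]
  have hs : (Matrix.toEuclideanLin (W - J)).IsSymmetric :=
    Matrix.isSymmetric_toEuclideanLin_iff.2 (Matrix.isHermitian_iff_isSymm.2 (hW.symm.sub hJs))
  -- The spectral radius bounds the eigenvalues in absolute value.
  have hμ : ∀ μ : ℝ, Module.End.HasEigenvalue (Matrix.toEuclideanLin (W - J)) μ → |μ| < 1 := by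
    intro μ h
    have h1 := h.mem_spectrum
    rw [Matrix.spectrum_toLpLin 2] at h1
    have h2 : (‖μ‖₊ : ENNReal) ≤ spectralRadius ℝ (W - J) :=
      le_iSup₂ (f := fun (k : ℝ) (_ : k ∈ spectrum ℝ (W - J)) => (‖k‖₊ : ENNReal)) μ h1
    have h3 : (‖μ‖₊ : ENNReal) < 1 := h2.trans_lt hW.spectral
    exact_mod_cast h3
  refine singularValues_one_of_contracting hW.isSymmetric (ones_ne_zero (by omega)) hW.map_ones
    (fun x hx hx0 => ?_) (by simpa using hn)
  have h := norm_map_lt_of_hasEigenvalue_abs_lt_one hs hμ hx0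
  have hWJ : Matrix.toEuclideanLin (W - J) x = Matrix.toEuclideanLin W x := by
    rw [inner_ones] at hx
    ext i
    simp only [toEuclideanLin_apply_apply, hJ, Matrix.sub_apply, Matrix.of_apply, sub_mul,
      Finset.sum_sub_distrib, ← Finset.mul_sum, hx, mul_zero, sub_zero]
  rwa [hWJ] at h

/-- As `W` vanishes off the neighbourhoods, the disagreement of EXTRA is `x - W x`. -/
lemma IsWeightMatrix.disagreement_eq (hW : IsWeightMatrix G W) (x : EuclideanSpace ℝ (Fin n))
    (i : Fin n) :
    disagreement G W x i = 2 * halfLaplacian (Matrix.toEuclideanLin W) x i := by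
  classical
  rw [disagreement, Finset.sum_subset (Finset.filter_subset _ _) fun j _ hj => ?_,
    halfLaplacian_apply, PiLp.smul_apply, PiLp.sub_apply, toEuclideanLin_apply_apply, smul_eq_mul]
  · ring
  · simp only [Finset.mem_filter, Finset.mem_univ, true_and, not_or] at hj
    rw [hW.support i j (Ne.symm hj.1) hj.2, zero_mul]

end WeightMatrix

/-! ### The primal-dual gap of the iteration -/

section PrimalDual

open scoped InnerProductSpace

variable {E : Type*} [NormedAddCommGroup E] [InnerProductSpace ℝ E]

/-- Summed over `T` steps, the Lagrangian gap of the primal-dual iteration, at a reference point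
`z` in the kernel of `K` and a reference dual variable `q`, stays bounded. -/
lemma sum_primal_dual_gap_le (K : E →ₗ[ℝ] E) (hK : K.IsSymmetric)
    (hK0 : ∀ x, 0 ≤ ⟪x, K x⟫_ℝ) (hK1 : ∀ x, ⟪x, K x⟫_ℝ ≤ ‖x‖ ^ 2)
    (F : E → ℝ) (g : E → E) {l β α : ℝ} (hl : 0 < l) (hβ : 0 < β) (hα : α = 1 / (2 * (l + β)))
    (hF : ∀ x y z, F y - F z ≤ ⟪g x, y - z⟫_ℝ + l * ‖y - x‖ ^ 2)
    (w v : ℕ → E) (hv0 : v 0 = 0)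
    (hw : ∀ t, w (t + 1) = w t - α • (g (w t) + v t + β • K (w t)))
    (hv : ∀ t, v (t + 1) = v t + β • K (w (t + 1)))
    (z q : E) (hz : K z = 0) (T : ℕ) :
    ∑ t ∈ Finset.range T, (F (w (t + 1)) - F z + ⟪K q, w (t + 1)⟫_ℝ) ≤
      (l + β) * ‖w 0 - z‖ ^ 2 + 1 / (2 * β) * ⟪q, K q⟫_ℝ := by
  -- The multiplier `v` stays in the range of `K`: it is `K y` for the accumulated iterates `y`.
  set y : ℕ → E := fun t => β • ∑ r ∈ Finset.range t, w (r + 1) with hy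
  have hy1 : ∀ t, y (t + 1) = y t + β • w (t + 1) := fun t => by
    simp only [hy, Finset.sum_range_succ, smul_add]
  have hvy : ∀ t, v t = K (y t) := by
    intro t
    induction t with
    | zero => simp [hv0, hy]
    | succ t ih => rw [hv, ih, hy1, map_add, map_smul K β (w (t + 1))]
  have hα' : 2 * (l + β) * α = 1 := by rw [hα]; field_simp
  -- A potential that decreases by at least the Lagrangian gap at every step.
  set Φ : ℕ → ℝ := fun t => (l + β) * ‖w t - z‖ ^ 2 - β / 2 * ⟪w t, K (w t)⟫_ℝ +
    1 / (2 * β) * ⟪y t - q, K (y t - q)⟫_ℝ with hΦ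
  have step : ∀ t, F (w (t + 1)) - F z + ⟪K q, w (t + 1)⟫_ℝ ≤
      Φ t - Φ (t + 1) - β / 2 * ⟪w (t + 1), K (w (t + 1))⟫_ℝ := by
    intro t
    set a := w t with ha
    set c := w (t + 1) with hc
    have h1 := hF a c z
    have hg : g a = (2 * (l + β)) • (a - c) - K (y t) - β • K a := by
      rw [hc, hw, hvy, ← ha, sub_sub_cancel, smul_smul, hα', one_smul]
      abel
    have hKz : ∀ x, ⟪K x, z⟫_ℝ = 0 := fun x => by rw [hK, hz, inner_zero_right]
    have e1 : 2 * ⟪a - c, c - z⟫_ℝ = ‖a - z‖ ^ 2 - ‖c - z‖ ^ 2 - ‖c - a‖ ^ 2 := by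
      have : a - z = (a - c) + (c - z) := by abel
      rw [this, norm_add_sq_real, norm_sub_rev c a]
      ring
    have e2 : ⟪y (t + 1) - q, K (y (t + 1) - q)⟫_ℝ = ⟪y t - q, K (y t - q)⟫_ℝ +
        2 * β * (⟪K (y t), c⟫_ℝ - ⟪K q, c⟫_ℝ) + β ^ 2 * ⟪c, K c⟫_ℝ := by
      have e : y (t + 1) - q = (y t - q) + β • c := by rw [hy1]; abel
      have e' : ⟪c, K (y t - q)⟫_ℝ = ⟪K (y t), c⟫_ℝ - ⟪K q, c⟫_ℝ := by
        rw [real_inner_comm, map_sub, inner_sub_left]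
      have e'' : ⟪y t - q, K c⟫_ℝ = ⟪K (y t), c⟫_ℝ - ⟪K q, c⟫_ℝ := by
        rw [← hK, map_sub, inner_sub_left]
      rw [e, map_add, map_smul, inner_add_left, inner_add_right, inner_add_right,
        inner_smul_left, inner_smul_left, inner_smul_right, inner_smul_right, e', e'']
      simp only [conj_trivial]
      ring
    have e3 : ⟪c - a, K (c - a)⟫_ℝ = ⟪c, K c⟫_ℝ - 2 * ⟪K a, c⟫_ℝ + ⟪a, K a⟫_ℝ := by
      rw [map_sub, inner_sub_left, inner_sub_right, inner_sub_right, ← hK a c,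
        real_inner_comm (K a) c]
      ring
    have e4 : ⟪g a, c - z⟫_ℝ = 2 * (l + β) * ⟪a - c, c - z⟫_ℝ - ⟪K (y t), c⟫_ℝ -
        β * ⟪K a, c⟫_ℝ := by
      rw [hg, inner_sub_left, inner_sub_left, inner_smul_left, inner_smul_left,
        inner_sub_right (K (y t)), inner_sub_right (K a), hKz, hKz]
      simp
    have h2 := mul_le_mul_of_nonneg_left (hK1 (c - a)) hβ.le
    have h3 : 0 ≤ β * ‖c - a‖ ^ 2 := by positivity
    have e5 : 1 / (2 * β) * ⟪y (t + 1) - q, K (y (t + 1) - q)⟫_ℝ =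
        1 / (2 * β) * ⟪y t - q, K (y t - q)⟫_ℝ + (⟪K (y t), c⟫_ℝ - ⟪K q, c⟫_ℝ) +
        β / 2 * ⟪c, K c⟫_ℝ := by
      rw [e2]; field_simp
    have e6 : 2 * (l + β) * ⟪a - c, c - z⟫_ℝ =
        (l + β) * (‖a - z‖ ^ 2 - ‖c - z‖ ^ 2 - ‖c - a‖ ^ 2) := by rw [← e1]; ring
    rw [e3] at h2
    simp only [hΦ, ← ha, ← hc]
    rw [e5]
    rw [e4, e6] at h1
    nlinarith
  -- The surplus `β/2 ⟪w m, K (w m)⟫` of the last step pays for the negative term of `Φ m`.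
  have htel : ∀ m, ∑ t ∈ Finset.range m, (F (w (t + 1)) - F z + ⟪K q, w (t + 1)⟫_ℝ) +
      (if m = 0 then 0 else β / 2 * ⟪w m, K (w m)⟫_ℝ) ≤ Φ 0 - Φ m := by
    intro m
    induction m with
    | zero => simp
    | succ m ih =>
      have h := step m
      have h0 : 0 ≤ if m = 0 then 0 else β / 2 * ⟪w m, K (w m)⟫_ℝ := by
        split_ifs
        · exact le_rfl
        · have := hK0 (w m); positivity
      rw [Finset.sum_range_succ, if_neg (Nat.succ_ne_zero m)]
      linarith
  have hfin := htel T
  have h1 := hK0 (y T - q)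
  have h2 := hK0 (w 0)
  have h3 : 0 ≤ (l + β) * ‖w T - z‖ ^ 2 := by positivity
  have h4 : Φ 0 ≤ (l + β) * ‖w 0 - z‖ ^ 2 + 1 / (2 * β) * ⟪q, K q⟫_ℝ := by
    have : 0 ≤ β / 2 * ⟪w 0, K (w 0)⟫_ℝ := by positivity
    simp only [hΦ, hy, Finset.range_zero, Finset.sum_empty, smul_zero, zero_sub, map_neg,
      inner_neg_neg]
    linarith
  have h5 : 0 ≤ 1 / (2 * β) * ⟪y T - q, K (y T - q)⟫_ℝ := by positivity
  rcases Nat.eq_zero_or_pos T with rfl | hT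
  · have := hK0 q
    simp only [Finset.range_zero, Finset.sum_empty]
    positivity
  · rw [if_neg hT.ne'] at hfin
    simp only [hΦ] at hfin h4
    linarith

/-- A bound on the Lagrangian gap that holds for every dual reference point bounds, for the
average `(∑ w) / T`, both the objective at its projection `m • e` onto the consensus line and the
distance `‖D‖` to that line. The reference point is chosen to cancel the gradient at `m • e` off
the consensus line and to point in the direction of `D`. -/
lemma consensus_gap_le [FiniteDimensional ℝ E] {A : E →ₗ[ℝ] E} (hA : A.IsSymmetric) {e : E}
    (he : e ≠ 0) (hAe : A e = e) {σ : ℝ} (hσ : σ < 1)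
    (hle : ∀ x, ⟪e, x⟫_ℝ = 0 → ‖A x‖ ≤ σ * ‖x‖)
    {F : E → ℝ} {g : E} {w : ℕ → E} {Fz a b m : ℝ} (hb : 0 ≤ b) {T : ℕ} {D : E}
    (hD : (T : ℝ) • (m • e + D) = ∑ t ∈ Finset.range T, w t) (heD : ⟪e, D⟫_ℝ = 0)
    (hg : ∀ y, F (m • e) + ⟪g, y - m • e⟫_ℝ ≤ F y)
    (hgap : ∀ q, ∑ t ∈ Finset.range T, (F (w t) - Fz + ⟪halfLaplacian A q, w t⟫_ℝ) ≤
      a + b * ⟪q, halfLaplacian A q⟫_ℝ)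
    {c : ℝ} (hc : 0 ≤ c) :
    T * (F (m • e) - Fz + c * ‖D‖) ≤ a + b * (2 / (1 - σ) * (‖g‖ + c) ^ 2) := by
  have he2 : ‖e‖ ^ 2 ≠ 0 := by simpa using he
  set r := ⟪e, g⟫_ℝ / ‖e‖ ^ 2 with hr
  set P := g - r • e with hP
  have heP : ⟪e, P⟫_ℝ = 0 := by
    rw [hP, inner_sub_right, inner_smul_right, real_inner_self_eq_norm_sq, hr,
      div_mul_cancel₀ _ he2, sub_self]
  have hPg : ‖P‖ ≤ ‖g‖ := by
    have hgP : g = r • e + P := by rw [hP]; abel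
    refine le_of_sq_le_sq ?_ (norm_nonneg _)
    rw [hgP, norm_add_sq_real, inner_smul_left, heP]
    nlinarith [sq_nonneg ‖r • e‖]
  set u := (c / ‖D‖) • D with hu
  have hun : ‖u‖ ≤ c := by
    rw [hu, norm_smul, norm_div, norm_norm, Real.norm_of_nonneg hc]
    rcases eq_or_ne ‖D‖ 0 with h | h
    · rw [h, mul_zero]; exact hc
    · rw [div_mul_cancel₀ _ h]
  have huD : ⟪u, D⟫_ℝ = c * ‖D‖ := by
    rw [hu, inner_smul_left, real_inner_self_eq_norm_sq]
    rcases eq_or_ne ‖D‖ 0 with h | h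
    · simp [h]
    · simp only [conj_trivial]; field_simp
  obtain ⟨q, hq, hqn⟩ := exists_halfLaplacian_eq hA he hAe hσ hle (v := u - P) (by
    rw [inner_sub_right, heP, hu, inner_smul_right, heD, mul_zero, sub_zero])
  have hvn : ‖u - P‖ ≤ ‖g‖ + c := (norm_sub_le u P).trans (by linarith)
  have hve : ⟪u - P, e⟫_ℝ = 0 := by
    rw [real_inner_comm, inner_sub_right, heP, hu, inner_smul_right, heD, mul_zero, sub_zero]
  have hgv : ⟪g, D⟫_ℝ + ⟪u - P, D⟫_ℝ = c * ‖D‖ := by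
    rw [inner_sub_left, huD, hP, inner_sub_left, inner_smul_left, heD]
    ring
  have hlow : T * (F (m • e) - Fz + c * ‖D‖) ≤
      ∑ t ∈ Finset.range T, (F (w t) - Fz + ⟪u - P, w t⟫_ℝ) := by
    have h1 : ∑ t ∈ Finset.range T, (F (m • e) - Fz + ⟪g, w t - m • e⟫_ℝ + ⟪u - P, w t⟫_ℝ) =
        T * (F (m • e) - Fz + c * ‖D‖) := by
      simp only [inner_sub_right, Finset.sum_add_distrib, Finset.sum_sub_distrib, ← inner_sum,
        ← hD, Finset.sum_const, Finset.card_range, nsmul_eq_mul]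
      rw [← Nat.cast_smul_eq_nsmul ℝ, inner_smul_right g _ (T : ℝ), inner_smul_right g _ (T : ℝ),
        inner_smul_right _ _ (T : ℝ),
        inner_add_right, inner_add_right,
        inner_smul_right (u - P) e, hve, ← hgv]
      ring
    rw [← h1]
    exact Finset.sum_le_sum fun t _ => by linarith [hg (w t)]
  have h2 := hgap q
  rw [hq] at h2 hqn
  refine (hlow.trans h2).trans ?_
  have hσ' : 0 < 1 - σ := by linarith
  have h3 : 2 / (1 - σ) * ‖u - P‖ ^ 2 ≤ 2 / (1 - σ) * (‖g‖ + c) ^ 2 := by gcongr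
  have h4 := mul_le_mul_of_nonneg_left (hqn.trans h3) hb
  linarith

end PrimalDual

/-! ### The convergence rate -/

section Rate

/-- The two uses of the family of gap bounds: `c = 0` for the objective gap `X`, and
`c = √(N R₂) + M √(R₁ / N)`, which balances the two error terms, for the distance `d` to
consensus. -/
lemma gap_add_mul_dist_lt {N M τ R₁ R₂ X d L T Γ : ℝ} (hN : 0 < N) (hM : 0 < M) (hτ : 0 < τ)
    (hτ1 : τ ≤ 1) (hR₁ : 0 ≤ R₁) (hR₂ : 0 < R₂) (hL : 0 ≤ L) (hT : 0 < T)
    (hΓ : 0 < Γ)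
    (h : ∀ c, 0 ≤ c → T * (X + c * d) ≤ (M / N + M / (N * τ)) * (N * R₁) +
      1 / (2 * (M / (N * τ))) * (2 / τ ^ 2 * (√N * √R₂ + c) ^ 2))
    (hX : 0 ≤ X)
    (hTb : 1 / (Γ * τ) * max (272 * (R₁ * M + R₂ * N ^ 2 / M))
      (32 * L * √N * (√R₁ + √R₂ * (N / M))) ≤ T) :
    X + L * d < Γ / 4 := by
  have hTτ : 0 < T * τ := by positivity
  -- With `τ ≤ 1` the step sizes contribute at most `2 M R₁ / τ`.
  have h' : ∀ c, 0 ≤ c → T * τ * (X + c * d) ≤ 2 * M * R₁ + N / M * (√N * √R₂ + c) ^ 2 := by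
    intro c hc
    calc T * τ * (X + c * d) = τ * (T * (X + c * d)) := by ring
      _ ≤ τ * ((M / N + M / (N * τ)) * (N * R₁) +
          1 / (2 * (M / (N * τ))) * (2 / τ ^ 2 * (√N * √R₂ + c) ^ 2)) :=
        mul_le_mul_of_nonneg_left (h c hc) hτ.le
      _ = (1 + τ) * M * R₁ + N / M * (√N * √R₂ + c) ^ 2 := by field_simp; ring
      _ ≤ 2 * M * R₁ + N / M * (√N * √R₂ + c) ^ 2 := by
        have : 0 ≤ M * R₁ := by positivity
        nlinarith
  have hmax : max (272 * (R₁ * M + R₂ * N ^ 2 / M))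
      (32 * L * √N * (√R₁ + √R₂ * (N / M))) ≤ T * τ * Γ := by
    rw [one_div, inv_mul_le_iff₀ (by positivity)] at hTb
    linarith
  have hA := (le_max_left _ _).trans hmax
  have hC := (le_max_right _ _).trans hmax
  have e1 : √R₁ ^ 2 = R₁ := Real.sq_sqrt hR₁
  have e2 : √R₂ ^ 2 = R₂ := Real.sq_sqrt hR₂.le
  have eN : √N ^ 2 = N := Real.sq_sqrt hN.le
  have hr1 : 0 ≤ √R₁ := Real.sqrt_nonneg _
  have hr2 : 0 < √R₂ := Real.sqrt_pos.2 hR₂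
  have hsN : 0 < √N := Real.sqrt_pos.2 hN
  have hX1 : T * τ * X ≤ T * τ * (Γ / 136) := by
    have h0 := h' 0 le_rfl
    have e : N / M * (√N * √R₂ + 0) ^ 2 = R₂ * N ^ 2 / M := by
      rw [add_zero, mul_pow, eN, e2]; ring
    rw [e, zero_mul, add_zero] at h0
    have : 0 ≤ R₂ * N ^ 2 / M := by positivity
    linarith
  have hXle : X ≤ Γ / 136 := le_of_mul_le_mul_left hX1 hTτ
  have hd : T * τ * d ≤ 6 * (√N * (√R₁ + √R₂ * (N / M))) := by
    set c := √N * √R₂ + M * √R₁ / √N with hc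
    have hcpos : 0 < c := by positivity
    have h1 := h' c hcpos.le
    have h2 : 2 * M * R₁ + N / M * (√N * √R₂ + c) ^ 2 ≤
        c * (6 * (√N * (√R₁ + √R₂ * (N / M)))) := by
      have h3 : c * √N = N * √R₂ + M * √R₁ := by
        rw [hc, add_mul, div_mul_cancel₀ _ hsN.ne', mul_right_comm, ← sq, eN]
      have h4 : (√N * √R₂ + c) ^ 2 * N = (2 * N * √R₂ + M * √R₁) ^ 2 := by
        have : (√N * √R₂ + c) * √N = 2 * N * √R₂ + M * √R₁ := by
          rw [add_mul, h3, mul_right_comm, ← sq, eN]; ring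
        rw [← this, mul_pow, eN]
      have h5 : N / M * (√N * √R₂ + c) ^ 2 = (2 * N * √R₂ + M * √R₁) ^ 2 / M := by
        rw [← h4]; ring
      have h6 : c * (6 * (√N * (√R₁ + √R₂ * (N / M)))) =
          6 * (N * √R₂ + M * √R₁) ^ 2 / M := by
        calc _ = 6 * (c * √N) * (√R₁ + √R₂ * (N / M)) := by ring
          _ = _ := by rw [h3]; field_simp; ring
      rw [h5, h6]
      have h7 : 2 * M * R₁ = 2 * (M * √R₁) ^ 2 / M := by rw [mul_pow, e1]; field_simp
      rw [h7, ← add_div]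
      refine div_le_div_of_nonneg_right ?_ hM.le
      nlinarith [sq_nonneg (N * √R₂), mul_nonneg (mul_nonneg hN.le hr2.le) (mul_nonneg hM.le hr1),
        sq_nonneg (M * √R₁)]
    have h8 : c * (T * τ * d) ≤ T * τ * (X + c * d) := by
      have : 0 ≤ T * τ * X := by positivity
      linarith
    exact le_of_mul_le_mul_left (h8.trans (h1.trans h2)) hcpos
  have hLd : T * τ * (L * d) ≤ T * τ * (6 / 32 * Γ) := by
    have := mul_le_mul_of_nonneg_left hd hL
    linarith
  have hLle : L * d ≤ 6 / 32 * Γ := le_of_mul_le_mul_left hLd hTτ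
  linarith

end Rate

/-! ### EXTRA in Euclidean space and the conclusion -/

section Extra

open scoped InnerProductSpace

variable {n : ℕ} {G : SimpleGraph (Fin n)} {W : Matrix (Fin n) (Fin n) ℝ}

/-- The gradient of the separable function `∑ i, ft i (x i)`. -/
noncomputable def separableGradient (ft : Fin n → ℝ → ℝ) (x : EuclideanSpace ℝ (Fin n)) :
    EuclideanSpace ℝ (Fin n) :=
  WithLp.toLp 2 fun i => deriv (ft i) (x i)

lemma inner_separableGradient (ft : Fin n → ℝ → ℝ) (x y : EuclideanSpace ℝ (Fin n)) :
    ⟪separableGradient ft x, y⟫_ℝ = ∑ i, deriv (ft i) (x i) * y i := by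
  simp [PiLp.inner_apply, separableGradient, mul_comm]

lemma extra_fst_succ (hW : IsWeightMatrix G W) (ft : Fin n → ℝ → ℝ) (a b : ℝ) (w0 : Fin n → ℝ)
    (t : ℕ) :
    WithLp.toLp 2 (extra G W ft a b w0 (t + 1)).1 = WithLp.toLp 2 (extra G W ft a b w0 t).1 -
      a • (separableGradient ft (WithLp.toLp 2 (extra G W ft a b w0 t).1) +
        WithLp.toLp 2 (extra G W ft a b w0 t).2 +
        b • halfLaplacian (Matrix.toEuclideanLin W)
          (WithLp.toLp 2 (extra G W ft a b w0 t).1)) := by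
  ext i
  have h := hW.disagreement_eq (WithLp.toLp 2 (extra G W ft a b w0 t).1) i
  simp only [extra, primalStep, separableGradient, PiLp.sub_apply, PiLp.smul_apply,
    PiLp.add_apply, smul_eq_mul] at h ⊢
  rw [h]
  ring

lemma extra_snd_succ (hW : IsWeightMatrix G W) (ft : Fin n → ℝ → ℝ) (a b : ℝ) (w0 : Fin n → ℝ)
    (t : ℕ) :
    WithLp.toLp 2 (extra G W ft a b w0 (t + 1)).2 = WithLp.toLp 2 (extra G W ft a b w0 t).2 +
      b • halfLaplacian (Matrix.toEuclideanLin W)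
        (WithLp.toLp 2 (extra G W ft a b w0 (t + 1)).1) := by
  ext i
  have h := hW.disagreement_eq (WithLp.toLp 2 (extra G W ft a b w0 (t + 1)).1) i
  simp only [PiLp.smul_apply, PiLp.add_apply, smul_eq_mul]
  change (extra G W ft a b w0 t).2 i +
    b / 2 * disagreement G W (extra G W ft a b w0 (t + 1)).1 i = _
  rw [h]
  ring

lemma IsSmoothApprox.separable_descent {f ft : Fin n → ℝ → ℝ} {L M U : ℝ}
    (hft : IsSmoothApprox f ft L M U) (x y z : EuclideanSpace ℝ (Fin n)) :
    ∑ i, ft i (y i) - ∑ i, ft i (z i) ≤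
      ⟪separableGradient ft x, y - z⟫_ℝ + M / n * ‖y - x‖ ^ 2 := by
  rw [inner_separableGradient, EuclideanSpace.real_norm_sq_eq, Finset.mul_sum,
    ← Finset.sum_sub_distrib, ← Finset.sum_add_distrib]
  exact Finset.sum_le_sum fun i _ =>
    sub_le_deriv_mul_add (hft.convex i) (hft.differentiable i) (hft.local_smooth i) _ _ _

lemma IsSmoothApprox.separable_gradient_le {f ft : Fin n → ℝ → ℝ} {L M U : ℝ}
    (hft : IsSmoothApprox f ft L M U) (x y : EuclideanSpace ℝ (Fin n)) :
    ∑ i, ft i (x i) + ⟪separableGradient ft x, y - x⟫_ℝ ≤ ∑ i, ft i (y i) := by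
  rw [inner_separableGradient, ← Finset.sum_add_distrib]
  exact Finset.sum_le_sum fun i _ => by
    have := deriv_mul_sub_le (hft.convex i) (hft.differentiable i) (x i) (y i)
    simp only [PiLp.sub_apply]
    linarith

lemma IsSmoothApprox.norm_separableGradient_le {p : ℝ} {s : Fin n → ℝ} {ft : Fin n → ℝ → ℝ}
    {L M U : ℝ} (hft : IsSmoothApprox (localLoss p s) ft L M U)
    (x : EuclideanSpace ℝ (Fin n)) :
    ‖separableGradient ft x‖ ≤ √(n : ℝ) * √(max (p ^ 2) ((1 - p) ^ 2)) := by
  rw [← Real.sqrt_mul (Nat.cast_nonneg n)]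
  refine Real.le_sqrt_of_sq_le ?_
  rw [EuclideanSpace.real_norm_sq_eq]
  calc _ ≤ ∑ _i : Fin n, max (p ^ 2) ((1 - p) ^ 2) := by
        refine Finset.sum_le_sum fun i _ => sq_le_max_sq_of_mem_Icc ?_
        obtain ⟨C, hC⟩ := hft.local_error i
        exact deriv_mem_Icc_of_abs_pinball_sub_le (hft.convex i) (hft.differentiable i) hC _
    _ = _ := by simp

end Extra

end TopK

theorem mainTheorem1 {n k : ℕ} (hk : 1 ≤ k ∧ k ≤ n)
    (s : Fin n → ℝ) (hs : ∃ i, s i ≠ TopK.kthLargest s k hk)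
    (G : SimpleGraph (Fin n)) (hG : G.Connected)
    (W : Matrix (Fin n) (Fin n) ℝ) (hW : TopK.IsWeightMatrix G W)
    (ft : Fin n → ℝ → ℝ) (L M U : ℝ)
    (hft : TopK.IsSmoothApprox (TopK.localLoss (TopK.quantileLevel n k) s) ft L M U)
    (hU : U ≤ TopK.multParam s k hk * TopK.minGap s k hk / 8)
    (θh : ℝ) (hθh : ∀ x, ∑ i, ft i θh ≤ ∑ i, ft i x)
    (w0 : Fin n → ℝ) (R₁ R₂ : ℝ)
    (hR₁ : ∀ i, |w0 i - θh| ^ 2 ≤ R₁) (hR₁' : |θh| ^ 2 ≤ R₁)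
    (hR₂ : R₂ = max (TopK.quantileLevel n k ^ 2) ((1 - TopK.quantileLevel n k) ^ 2))
    (T : ℕ)
    (hT : 1 / (TopK.multParam s k hk * TopK.minGap s k hk * √(1 - TopK.sigmaTwo W)) *
        max (272 * (R₁ * M + R₂ * (n : ℝ) ^ 2 / M))
          (32 * L * √(n : ℝ) * (√R₁ + √R₂ * ((n : ℝ) / M))) ≤ (T : ℝ)) :
    ∀ i, TopK.runningAverage G W ft (TopK.alpha W M) (TopK.beta W M) w0 T i ∈
      TopK.optimalInterval s k hk := by
  open TopK in
  have hM : 0 < M := hft.smoothness_pos hk hθh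
  have hn : 1 < n := by
    obtain ⟨i, hi⟩ := hs
    by_contra h
    have : Subsingleton (Fin n) := Fin.subsingleton_iff_le_one.2 (by omega)
    exact hi (congrArg s (Subsingleton.elim _ _))
  have hN : (0 : ℝ) < n := by exact_mod_cast (by omega : 0 < n)
  have hg := multParam_pos s hk
  have hΔ := minGap_pos s hk hs
  obtain ⟨hσ, hσle⟩ := hW.sigmaTwo_spec hn
  set σ := sigmaTwo W with hσdef
  have hσ0 : 0 ≤ σ := LinearMap.singularValues_nonneg _ 1
  set τ := √(1 - σ) with hτdef
  have hτ : 0 < τ := Real.sqrt_pos.2 (by linarith)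
  have hτ1 : τ ≤ 1 := Real.sqrt_le_one.2 (by linarith)
  have hτsq : τ ^ 2 = 1 - σ := Real.sq_sqrt (by linarith)
  have hp := quantileLevel_mem hk
  have hR₂pos : 0 < R₂ := by
    rw [hR₂]; exact lt_max_of_lt_left (pow_pos hp.1 2)
  have hR₁0 : 0 ≤ R₁ := (sq_nonneg _).trans hR₁'
  have hL : 0 ≤ L := by
    have := (abs_nonneg _).trans (hft.lipschitz 1 0)
    simpa using this
  -- The lower bound on `T` is positive, so the running average is not a division by zero.
  have hTpos : (0 : ℝ) < T := by
    refine lt_of_lt_of_le ?_ hT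
    have : 0 < max (272 * (R₁ * M + R₂ * (n : ℝ) ^ 2 / M))
        (32 * L * √(n : ℝ) * (√R₁ + √R₂ * ((n : ℝ) / M))) :=
      lt_max_of_lt_left (by positivity)
    positivity
  have hβ : 0 < beta W M := by unfold beta; positivity
  set w : ℕ → EuclideanSpace ℝ (Fin n) :=
    fun t => WithLp.toLp 2 (extra G W ft (alpha W M) (beta W M) w0 t).1 with hw
  set avg : EuclideanSpace ℝ (Fin n) :=
    WithLp.toLp 2 (runningAverage G W ft (alpha W M) (beta W M) w0 T) with havg
  have hTavg : (T : ℝ) • avg = ∑ t ∈ Finset.range T, w (t + 1) := by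
    ext i
    have h1 : ∑ t ∈ Finset.Icc 1 T, (extra G W ft (alpha W M) (beta W M) w0 t).1 i =
        ∑ t ∈ Finset.range T, (extra G W ft (alpha W M) (beta W M) w0 (t + 1)).1 i := by
      rw [Finset.range_eq_Ico, Finset.sum_Ico_add'
        (fun t => (extra G W ft (alpha W M) (beta W M) w0 t).1 i)]
      rfl
    simp only [havg, hw, PiLp.smul_apply, WithLp.ofLp_sum, Finset.sum_apply, runningAverage,
      smul_eq_mul, h1]
    field_simp
  -- The running average splits into its mean over the agents and a deviation from consensus.
  set m : ℝ := (∑ i, avg i) / n with hm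
  set D := avg - m • ones n with hD
  have hones : ∀ (r : ℝ) (i : Fin n), (r • ones n) i = r := fun r i => by simp [ones]
  have heD : inner ℝ (ones n) D = 0 := by
    rw [inner_ones]
    simp only [hD, PiLp.sub_apply, hones, Finset.sum_sub_distrib, Finset.sum_const,
      Finset.card_univ, Fintype.card_fin, nsmul_eq_mul, hm]
    field_simp
    ring
  have hmem := inner_halfLaplacian_mem_Icc
    (norm_map_le_of_contracting hW.isSymmetric hW.map_ones hσ.le hσle)
  have hdist : ‖w 0 - θh • ones n‖ ^ 2 ≤ n * R₁ := by
    rw [EuclideanSpace.real_norm_sq_eq]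
    calc _ ≤ ∑ _i : Fin n, R₁ := Finset.sum_le_sum fun i _ => by
          rw [PiLp.sub_apply, hones, ← sq_abs]
          exact hR₁ i
      _ = n * R₁ := by simp
  have hgap : ∀ c, 0 ≤ c → T * ((∑ i, ft i m - ∑ i, ft i θh) + c * ‖D‖) ≤
      (M / n + M / (n * τ)) * (n * R₁) +
        1 / (2 * (M / (n * τ))) * (2 / τ ^ 2 * (√(n : ℝ) * √R₂ + c) ^ 2) := by
    intro c hc
    have h1 := consensus_gap_le hW.isSymmetric (ones_ne_zero (by omega)) hW.map_ones hσ hσle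
      (F := fun x => ∑ i, ft i (x i)) (g := separableGradient ft (m • ones n))
      (w := fun t => w (t + 1)) (Fz := ∑ i, ft i ((θh • ones n) i))
      (a := (M / n + beta W M) * ‖w 0 - θh • ones n‖ ^ 2) (b := 1 / (2 * beta W M)) (m := m)
      (by positivity) (D := D) (by rw [hD, add_sub_cancel, hTavg]) heD
      (fun y => hft.separable_gradient_le (m • ones n) y)
      (fun q => sum_primal_dual_gap_le _ (isSymmetric_halfLaplacian hW.isSymmetric)
        (fun x => (hmem x).1) (fun x => (hmem x).2) (fun x => ∑ i, ft i (x i))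
        (separableGradient ft) (by positivity) hβ rfl hft.separable_descent w
        (fun t => WithLp.toLp 2 (extra G W ft (alpha W M) (beta W M) w0 t).2) rfl
        (extra_fst_succ hW ft _ _ w0) (extra_snd_succ hW ft _ _ w0) (θh • ones n) q
        (by rw [map_smul, halfLaplacian_apply, hW.map_ones, sub_self, smul_zero, smul_zero]) T) hc
    simp only [hones] at h1
    have hgn := hft.norm_separableGradient_le (m • ones n)
    rw [← hR₂] at hgn
    have hβe : beta W M = M / (n * τ) := rfl
    rw [hβe] at h1
    refine h1.trans ?_
    rw [← hτsq]
    gcongr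
  have hX : 0 ≤ ∑ i, ft i m - ∑ i, ft i θh := sub_nonneg.2 (hθh m)
  have hsmall := gap_add_mul_dist_lt hN hM hτ hτ1 hR₁0 hR₂pos hL hTpos
    (mul_pos hg hΔ) hgap hX hT
  intro i
  change avg i ∈ _
  have hlip : ∑ j, ft j (avg i) - ∑ j, ft j m ≤ L * ‖D‖ := by
    have h1 := (le_abs_self _).trans (hft.lipschitz (avg i) m)
    have h2 : |avg i - m| ≤ ‖D‖ := by
      have := PiLp.norm_apply_le D i
      rwa [hD, PiLp.sub_apply, hones, Real.norm_eq_abs] at this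
    exact h1.trans (mul_le_mul_of_nonneg_left h2 hL)
  -- Passing between `f` and its approximation at both points costs `2 U ≤ g_m Δ / 4`.
  have hgrow := multParam_mul_abs_le s hk (avg i)
  have h1 := (abs_le.1 (hft.error (avg i))).2
  have h2 := (abs_le.1 (hft.error (kthLargest s k hk))).1
  have h3 := hθh (kthLargest s k hk)
  have h4 : multParam s k hk * |avg i - kthLargest s k hk| <
      multParam s k hk * (minGap s k hk / 2) := by linarith
  have h5 := abs_lt.1 (lt_of_mul_lt_mul_left h4 hg.le)
  unfold optimalInterval
  exact ⟨by linarith [h5.1], by linarith [h5.2]⟩
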